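/- **Conventions.** Let $\Delta\subset\mathbb R^d$ be a lattice simplex of dimension $d$ with vertices $v_0,\dots,v_d\in\mathbb Z^d$. Its $\delta$-polynomial is $$\delta(\Delta,t)=(1-t)^{d+1}\sum_{n\ge 0}\#(n\Delta\cap\mathbb Z^d)\,t^n ,$$ and its associated finite abelian group is $$\Lambda_\Delta=\Big\{(\lambda_0,\dots,\lambda_d)\in(\mathbb R/\mathbb Z)^{d+1} : \sum_{i=0}^d\lambda_i(v_i,1)\in\mathbb Z^{d+1}\Big\}.$$ Two lattice polytopes $P,Q\subset\mathbb R^d$ are unimodularly equivalent if $Q=\{xU : x\in P\}+w$ for an integer matrix $U$ with $\det U=\pm1$ and some $w\in\mathbb Z^d$. The simplex $\Delta$ is a lattice pyramid over a lower-dimensional lattice simplex if $d\ge1$ and $\Delta$ is unimodularly equivalent to $\mathrm{conv}\big((\Delta'\times\{0\})\cup\{(0,\dots,0,1)\}\big)$ for some lattice simplex $\Delta'\subset\mathbb R^{d-1}$ of dimension $d-1$. **Statement.** Let $p$ be a prime, $\ell$ a positive integer and $k$ a nonnegative integer, and let $\Delta\subset\mathbb R^d$ be a lattice simplex of dimension $d$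 such that $\Lambda_\Delta$ is cyclic and $$\delta(\Delta,t)=1+t^{k+1}+t^{2(k+1)}+\cdots+t^{(p^\ell-1)(k+1)} .$$ Suppose that $\Delta$ is not a lattice pyramid over any lower-dimensional lattice simplex. Then there exist an integer $t\ge1$, integers $0<\ell_1<\cdots<\ell_t=\ell$ and positive integers $s_1,\dots,s_t$ such that, with $\ell_0=0$, $$s_i=\begin{cases}(p^{\ell-\ell_{i-1}}-p^{\ell-\ell_{i+1}})(k+1), & 1\le i\le t-1,\\ p^{\ell-\ell_{t-1}}(k+1), & i=t,\end{cases}$$ and, for some ordering of the vertices of $\Delta$, the group $\Lambda_\Delta$ is generated by $$\Big(\underbrace{1/p^{\ell_1},\dots,1/p^{\ell_1}}_{s_1},\underbrace{1/p^{\ell_2},\dots,1/p^{\ell_2}}_{s_2},\dots,\underbrace{1/p^{\ell_t},\dots,1/p^{\ell_t}}_{s_t}\Big)\in(\mathbb R/\mathbb Z)^{d+1}$$ (in particular $s_1+\cdots+s_t=d+1$). -/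

import Mathlib

noncomputable section

open scoped Pointwise

namespace GorensteinSimplex

/-- The real vector with the given integer coordinates. -/
def toReal {d : ℕ} (z : Fin d → ℤ) : Fin d → ℝ := fun j => (z j : ℝ)

/-- A lattice simplex of dimension `d` in `ℝ^d`, given by its `d + 1` affinely independent
lattice vertices. -/
structure LatticeSimplex (d : ℕ) where
  /-- The vertices `v_0, …, v_d`. -/
  vertex : Fin (d + 1) → Fin d → ℤ
  affineIndependent : AffineIndependent ℝ (fun i => toReal (vertex i))

/-- The simplex as a subset of `ℝ^d`. -/
def LatticeSimplex.body {d : ℕ} (Δ : LatticeSimplex d) : Set (Fin d → ℝ) :=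
  convexHull ℝ (Set.range fun i => toReal (Δ.vertex i))

/-- The number `#(nP ∩ ℤ^d)` of lattice points in the `n`-th dilate of `P`. -/
def ehrhartCount {d : ℕ} (P : Set (Fin d → ℝ)) (n : ℕ) : ℕ :=
  Set.ncard {z : Fin d → ℤ | toReal z ∈ (n : ℝ) • P}

/-- `δ(P, t) = (1 - t)^(d+1) ∑_{n ≥ 0} #(nP ∩ ℤ^d) t^n` for a lattice polytope `P ⊂ ℝ^d` of
dimension `d`, as a formal power series (the term for `n = 0` is `1`, since `0 P = {0}`). -/
def deltaSeries {d : ℕ} (P : Set (Fin d → ℝ)) : PowerSeries ℤ :=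
  (1 - PowerSeries.X) ^ (d + 1) * PowerSeries.mk (fun n => (ehrhartCount P n : ℤ))

/-- The group of all `λ ∈ (ℝ/ℤ)^ι` such that `∑ i, λ_i (v_i, 1) ∈ ℤ^(d+1)`, that is, such that
`∑ i, λ_i (v_i, 1)` vanishes in `(ℝ/ℤ)^(d+1)`. -/
def associatedGroup {ι : Type*} [Fintype ι] {d : ℕ} (v : ι → Fin d → ℤ) :
    AddSubgroup (ι → UnitAddCircle) where
  carrier := {x | (∀ j, ∑ i, v i j • x i = 0) ∧ ∑ i, x i = 0}
  zero_mem' := by simp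
  add_mem' := by
    rintro a b ⟨ha, ha'⟩ ⟨hb, hb'⟩
    refine ⟨fun j => ?_, ?_⟩
    · simp [smul_add, Finset.sum_add_distrib, ha j, hb j]
    · simp [Finset.sum_add_distrib, ha', hb']
  neg_mem' := by
    rintro a ⟨ha, ha'⟩
    refine ⟨fun j => ?_, ?_⟩
    · simp [ha j]
    · simp [ha']

/-- `Q = f_U(P) + w` for a unimodular integer matrix `U` and an integer vector `w`, where
`f_U(x) = x U`. -/
def UnimodularlyEquivalent {d : ℕ} (P Q : Set (Fin d → ℝ)) : Prop :=
  ∃ (U : Matrix (Fin d) (Fin d) ℤ) (w : Fin d → ℤ), (U.det = 1 ∨ U.det = -1) ∧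
    Q = (fun x => Matrix.vecMul x (U.map (Int.cast : ℤ → ℝ)) + toReal w) '' P

/-- `Pyr(P) = conv(P × {0}, (0, …, 0, 1)) ⊂ ℝ^(d+1)`. -/
def pyramid {d : ℕ} (P : Set (Fin d → ℝ)) : Set (Fin (d + 1) → ℝ) :=
  convexHull ℝ
    (insert (Fin.snoc (α := fun _ => ℝ) (0 : Fin d → ℝ) 1)
      ((fun x : Fin d → ℝ => Fin.snoc (α := fun _ => ℝ) x 0) '' P))

/-- `P` is, up to unimodular equivalence, the lattice pyramid over a lattice simplex of one
dimension less. (An iterated pyramid over a simplex of still smaller dimension is of this form.) -/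
def IsLatticePyramid : (d : ℕ) → Set (Fin d → ℝ) → Prop
  | 0, _ => False
  | d + 1, P => ∃ Q : LatticeSimplex d, UnimodularlyEquivalent (pyramid Q.body) P

end GorensteinSimplex

end

/-!
A lattice point of `nΔ` is determined by the fractional and the integral parts of its coordinates
with respect to the vectors `(v_i, 1)`, that is, by some `x ∈ Λ_Δ` and some `m ∈ ℕ^(d+1)` with
`height x + ∑ i, m i = n`. So `δ(Δ, t) = ∑ x, t ^ height x`, and the hypothesis says that the
heights on `Λ_Δ` are `0, c, 2c, …` with `c = k + 1`, each attained once.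

Let `x` have height `c` and order `N`. Heights are subadditive and distinct, so if `y` is minimal in
its coset of `⟨x⟩`, then `y + jx` has height exactly `height y + jc` for `j < N`: no carry occurs in
any coordinate. Taking `y = 0` shows that every nonzero coordinate of `x` is `1 / N`. Multiplying
these coordinates by `N` and dividing their weights by `N` therefore gives coordinates on
`Λ_Δ / ⟨x⟩` whose weighted heights are `0, cN, 2cN, …`, each attained once, which allows induction
on the order `p ^ ℓ`. A generator of the quotient lifts, and the support of `x` becomes a new top
block. This block is cut out of the old top block: a coordinate that does not vanish at `x` has full
order `N` there, hence is injective on the cyclic `p`-group `Λ_Δ`.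

Finally, if a coordinate vanishes identically on `Λ_Δ`, then the corresponding barycentric
coordinate is an integral affine function, equal to `1` at one vertex and to `0` at all others, and
`Δ` is a lattice pyramid.
-/

namespace GorensteinSimplex

open scoped Pointwise

/-! ### Height rankings and their quotients -/

/-- The representative in `[0, 1)` of a point of `ℝ/ℤ`. -/
noncomputable def frac (x : UnitAddCircle) : ℝ := AddCircle.equivIco (1 : ℝ) 0 x

theorem frac_nonneg (x : UnitAddCircle) : 0 ≤ frac x := (AddCircle.equivIco (1 : ℝ) 0 x).2.1

theorem frac_lt_one (x : UnitAddCircle) : frac x < 1 :=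
  (AddCircle.equivIco (1 : ℝ) 0 x).2.2.trans_eq (zero_add 1)

theorem coe_frac (x : UnitAddCircle) : (frac x : UnitAddCircle) = x := AddCircle.coe_equivIco

theorem frac_coe (r : ℝ) : frac (r : UnitAddCircle) = Int.fract r := by
  simp only [frac, AddCircle.coe_equivIco_mk_apply, div_one, mul_one]

theorem frac_coe_of_mem {r : ℝ} (h0 : 0 ≤ r) (h1 : r < 1) : frac (r : UnitAddCircle) = r := by
  rw [frac_coe, Int.fract_eq_self.2 ⟨h0, h1⟩]

theorem frac_coe_le {r : ℝ} (h : 0 ≤ r) : frac (r : UnitAddCircle) ≤ r := by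
  rw [frac_coe, Int.fract]
  exact sub_le_self r (mod_cast Int.floor_nonneg.2 h)

theorem frac_zero : frac 0 = 0 := by
  simpa only [AddCircle.coe_zero] using frac_coe_of_mem le_rfl one_pos

theorem frac_add_le (x y : UnitAddCircle) : frac (x + y) ≤ frac x + frac y := by
  nth_rw 1 [← coe_frac x, ← coe_frac y, ← AddCircle.coe_add]
  exact frac_coe_le (add_nonneg (frac_nonneg x) (frac_nonneg y))

theorem frac_nsmul_le (n : ℕ) (x : UnitAddCircle) : frac (n • x) ≤ n * frac x := by
  nth_rw 1 [← coe_frac x, ← AddCircle.coe_nsmul, ← nsmul_eq_mul]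
  exact frac_coe_le (nsmul_nonneg (frac_nonneg x) n)

theorem frac_nsmul_of_lt {n : ℕ} {x : UnitAddCircle} (h : n * frac x < 1) :
    frac (n • x) = n * frac x := by
  nth_rw 1 [← coe_frac x, ← AddCircle.coe_nsmul, nsmul_eq_mul]
  exact frac_coe_of_mem (mul_nonneg n.cast_nonneg (frac_nonneg x)) h

theorem coe_eq_zero_iff_exists_int {r : ℝ} : (r : UnitAddCircle) = 0 ↔ ∃ m : ℤ, r = m := by
  rw [AddCircle.coe_eq_zero_iff]
  simp only [zsmul_one, eq_comm]

theorem addOrderOf_coe_one_div_pow {p : ℕ} (hp : 0 < p) (m : ℕ) :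
    addOrderOf ((1 / (p : ℝ) ^ m : ℝ) : UnitAddCircle) = p ^ m := by
  simpa only [Nat.cast_pow] using AddCircle.addOrderOf_period_div (p := (1 : ℝ)) (pow_pos hp m)

section CosetMin

variable {G : Type*} [AddCommGroup G] {rk : G → ℕ} {x y : G}

/-- The element `y` has the least rank among `y, y + x, y + 2x, …`; when `x` has finite order, this
is the coset of `y` modulo `x`. -/
def IsCosetMin (rk : G → ℕ) (x y : G) : Prop := ∀ j : ℕ, rk y ≤ rk (y + j • x)

theorem exists_isCosetMin_add_nsmul [Finite G] (rk : G → ℕ) (x z : G) :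
    ∃ y, IsCosetMin rk x y ∧ ∃ j < addOrderOf x, z = y + j • x := by
  classical
  obtain ⟨y, hy, hmin⟩ := Set.exists_min_image {y | z - y ∈ AddSubgroup.zmultiples x} rk
    (Set.toFinite _) ⟨z, by simp⟩
  obtain ⟨j, hj, hjx⟩ := Finset.mem_image.1 (mem_zmultiples_iff_mem_range_addOrderOf.1 hy)
  refine ⟨y, fun i => hmin _ ?_, j, Finset.mem_range.1 hj, by rw [hjx, add_sub_cancel]⟩
  rw [Set.mem_ofPred_eq, ← sub_sub]
  exact sub_mem hy (AddSubgroup.nsmul_mem_zmultiples x i)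

theorem exists_isCosetMin_mk_eq [Finite G] (rk : G → ℕ) (x : G)
    (q : G ⧸ AddSubgroup.zmultiples x) :
    ∃ y : G, IsCosetMin rk x y ∧ (y : G ⧸ AddSubgroup.zmultiples x) = q := by
  obtain ⟨z, rfl⟩ := QuotientAddGroup.mk_surjective q
  obtain ⟨y, hy, j, -, rfl⟩ := exists_isCosetMin_add_nsmul rk x z
  refine ⟨y, hy, QuotientAddGroup.eq.2 ?_⟩
  rw [neg_add_cancel_left]
  exact AddSubgroup.nsmul_mem_zmultiples x j

end CosetMin

/-- `rk` enumerates the values of the weighted height `g ↦ ∑ i, ω i * frac (χ i g)` on the finite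
group `G`: the heights are the numbers `c * r` with `r < |G|`, each attained once. -/
structure IsHeightRanking {G ι : Type*} [AddCommGroup G] [Fintype ι]
    (χ : ι → G →+ UnitAddCircle) (ω : ι → ℝ) (c : ℝ) (rk : G → ℕ) : Prop where
  weight_pos : ∀ i, 0 < ω i
  pos : 0 < c
  height_eq : ∀ g, ∑ i, ω i * frac (χ i g) = c * rk g
  injective : Function.Injective rk
  lt_card : ∀ g, rk g < Nat.card G

section Quotient

variable {G ι : Type*} [AddCommGroup G] (χ : ι → G →+ UnitAddCircle) (ω : ι → ℝ) (x : G)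

/-- The characters of `G ⧸ ⟨x⟩` induced by those of `G`: the multiple of `χ i` by the order of
`χ i x` vanishes at `x`. -/
noncomputable def quotientChar (i : ι) : G ⧸ AddSubgroup.zmultiples x →+ UnitAddCircle :=
  QuotientAddGroup.lift _ (addOrderOf (χ i x) • χ i) <| by
    rw [AddSubgroup.zmultiples_le, AddMonoidHom.mem_ker, AddMonoidHom.nsmul_apply,
      addOrderOf_nsmul_eq_zero]

/-- The weights for which `quotientChar` has the heights of the coset minima. -/
noncomputable def quotientWeight (i : ι) : ℝ := ω i / addOrderOf (χ i x)

theorem quotientChar_mk (i : ι) (g : G) :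
    quotientChar χ x i g = addOrderOf (χ i x) • χ i g := rfl

variable {χ x} in
theorem quotientChar_mk_of_eq_zero {i : ι} (hi : χ i x = 0) (g : G) :
    quotientChar χ x i g = χ i g := by
  rw [quotientChar_mk, hi, addOrderOf_zero, one_nsmul]

end Quotient

namespace IsHeightRanking

variable {G ι : Type*} [AddCommGroup G] [Fintype ι]
  {χ : ι → G →+ UnitAddCircle} {ω : ι → ℝ} {c : ℝ} {rk : G → ℕ} {x y : G}

theorem exists_rank_eq (H : IsHeightRanking χ ω c rk) {r : ℕ} (hr : r < Nat.card G) :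
    ∃ g, rk g = r := by
  have hbij : Function.Bijective fun g => (⟨rk g, H.lt_card g⟩ : Fin (Nat.card G)) :=
    (Nat.bijective_iff_injective_and_card _).2
      ⟨fun a b h => H.injective (Fin.mk.inj h), (Nat.card_fin _).symm⟩
  obtain ⟨g, hg⟩ := hbij.2 ⟨r, hr⟩
  exact ⟨g, Fin.mk.inj hg⟩

theorem rank_zero (H : IsHeightRanking χ ω c rk) : rk 0 = 0 := by
  have h := H.height_eq 0
  simp only [map_zero, frac_zero, mul_zero, Finset.sum_const_zero] at h
  exact_mod_cast (mul_eq_zero.1 h.symm).resolve_left H.pos.ne'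

theorem ne_zero_of_rank_eq_one (H : IsHeightRanking χ ω c rk) (hx : rk x = 1) : x ≠ 0 := by
  rintro rfl
  exact zero_ne_one (H.rank_zero.symm.trans hx)

theorem rank_add_le (H : IsHeightRanking χ ω c rk) (g g' : G) : rk (g + g') ≤ rk g + rk g' := by
  suffices h : c * (rk (g + g') : ℝ) ≤ c * ((rk g + rk g' : ℕ) : ℝ) by
    have h' := le_of_mul_le_mul_left h H.pos
    exact_mod_cast h'
  calc c * (rk (g + g') : ℝ) = ∑ i, ω i * frac (χ i g + χ i g') := by
        simp only [← H.height_eq, map_add]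
    _ ≤ ∑ i, ω i * (frac (χ i g) + frac (χ i g')) :=
        Finset.sum_le_sum fun i _ =>
          mul_le_mul_of_nonneg_left (frac_add_le _ _) (H.weight_pos i).le
    _ = c * ((rk g + rk g' : ℕ) : ℝ) := by
        simp only [mul_add, Finset.sum_add_distrib, H.height_eq, Nat.cast_add]

theorem rank_add_nsmul (H : IsHeightRanking χ ω c rk) (hx : rk x = 1) (hy : IsCosetMin rk x y)
    {j : ℕ} (hj : j < addOrderOf x) : rk (y + j • x) = rk y + j := by
  induction j using Nat.strong_induction_on with
  | _ j ih =>
    rcases j with _ | j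
    · simp only [zero_nsmul, add_zero]
    have hle : rk (y + (j + 1) • x) ≤ rk y + (j + 1) := by
      have h := H.rank_add_le (y + j • x) x
      rwa [add_assoc, ← succ_nsmul, ih j j.lt_succ_self (by lia), hx, add_assoc] at h
    -- a smaller rank in the window above `rk y` is already taken by an earlier multiple of `x`
    by_contra hne
    obtain ⟨m, hm⟩ := Nat.exists_eq_add_of_le (hy (j + 1))
    have hrk : rk (y + m • x) = rk (y + (j + 1) • x) := by
      rw [ih m (by lia) (by lia), hm]
    have hmj : m = j + 1 := nsmul_injOn_Iio_addOrderOf (x := x) (Set.mem_Iio.2 (by lia))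
      (Set.mem_Iio.2 hj) (add_left_cancel (H.injective hrk))
    lia

theorem frac_add_nsmul (H : IsHeightRanking χ ω c rk) (hx : rk x = 1) (hy : IsCosetMin rk x y)
    {j : ℕ} (hj : j < addOrderOf x) (i : ι) :
    frac (χ i (y + j • x)) = frac (χ i y) + j * frac (χ i x) := by
  have hle : ∀ i ∈ Finset.univ, ω i * frac (χ i (y + j • x)) ≤
      ω i * (frac (χ i y) + j * frac (χ i x)) := fun i _ => by
    refine mul_le_mul_of_nonneg_left ?_ (H.weight_pos i).le
    rw [map_add, map_nsmul]
    exact (frac_add_le _ _).trans (add_le_add_right (frac_nsmul_le _ _) _)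
  have hsum : ∑ i, ω i * frac (χ i (y + j • x)) =
      ∑ i, ω i * (frac (χ i y) + j * frac (χ i x)) := by
    simp only [mul_add, Finset.sum_add_distrib, mul_left_comm (ω _) (j : ℝ), ← Finset.mul_sum,
      H.height_eq, H.rank_add_nsmul hx hy hj, hx]
    push_cast
    ring
  exact mul_left_cancel₀ (H.weight_pos i).ne'
    ((Finset.sum_eq_sum_iff_of_le hle).1 hsum i (Finset.mem_univ i))

theorem isCosetMin_zero (H : IsHeightRanking χ ω c rk) (x : G) : IsCosetMin rk x 0 := fun _ =>
  H.rank_zero.trans_le (Nat.zero_le _)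

theorem sum_mul_frac_of_superset (H : IsHeightRanking χ ω c rk) (hx : rk x = 1) {s : Finset ι}
    (hs : ∀ i, χ i x ≠ 0 → i ∈ s) : ∑ i ∈ s, ω i * frac (χ i x) = c := by
  rw [Finset.sum_subset s.subset_univ fun i _ hi => ?_, H.height_eq, hx, Nat.cast_one, mul_one]
  rw [not_not.1 (mt (hs i) hi), frac_zero, mul_zero]

theorem exists_apply_ne_zero (H : IsHeightRanking χ ω c rk) (hx : rk x = 1) :
    ∃ i, χ i x ≠ 0 := by
  by_contra! hzero
  have h := H.height_eq x
  simp only [hzero, frac_zero, mul_zero, Finset.sum_const_zero, hx, Nat.cast_one, mul_one] at h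
  exact H.pos.ne h

variable [Finite G]

theorem one_lt_addOrderOf (H : IsHeightRanking χ ω c rk) (hx : rk x = 1) : 1 < addOrderOf x := by
  have hne : addOrderOf x ≠ 1 := mt AddMonoid.addOrderOf_eq_one_iff.1 (H.ne_zero_of_rank_eq_one hx)
  have hpos := addOrderOf_pos x
  lia

theorem frac_add_pred_mul_lt_one (H : IsHeightRanking χ ω c rk) (hx : rk x = 1)
    (hy : IsCosetMin rk x y) (i : ι) :
    frac (χ i y) + (addOrderOf x - 1 : ℝ) * frac (χ i x) < 1 := by
  have hN := addOrderOf_pos x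
  have h := frac_lt_one (χ i (y + (addOrderOf x - 1) • x))
  rwa [H.frac_add_nsmul hx hy (Nat.sub_lt hN one_pos), Nat.cast_pred hN] at h

theorem apply_eq_of_ne_zero (H : IsHeightRanking χ ω c rk) (hx : rk x = 1) {i : ι}
    (hi : χ i x ≠ 0) : χ i x = ((1 / addOrderOf x : ℝ) : UnitAddCircle) := by
  have hN := H.one_lt_addOrderOf hx
  have hN0 : (0 : ℝ) < addOrderOf x := by positivity
  obtain ⟨m, hmN, hm⟩ := (AddCircle.nsmul_eq_zero_iff (u := χ i x) (addOrderOf_pos x)).1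
    (by rw [← map_nsmul, addOrderOf_nsmul_eq_zero, map_zero])
  rw [mul_one] at hm
  have hfrac : frac (χ i x) = m / addOrderOf x := by
    rw [← hm, frac_coe_of_mem (by positivity) ((div_lt_one hN0).2 (mod_cast hmN))]
  have hlt : ((addOrderOf x : ℝ) - 1) * m < addOrderOf x := by
    have h := H.frac_add_pred_mul_lt_one hx (H.isCosetMin_zero x) i
    rwa [map_zero, frac_zero, zero_add, hfrac, mul_div_assoc', div_lt_one hN0] at h
  have hm2 : m < 2 := by
    by_contra! hm2
    have h2m : (2 : ℝ) ≤ m := mod_cast hm2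
    have h2N : (2 : ℝ) ≤ addOrderOf x := mod_cast hN
    nlinarith
  have hm0 : m ≠ 0 := by
    rintro rfl
    rw [Nat.cast_zero, zero_div, AddCircle.coe_zero] at hm
    exact hi hm.symm
  rw [← hm, show m = 1 by lia, Nat.cast_one]

theorem frac_apply_of_ne_zero (H : IsHeightRanking χ ω c rk) (hx : rk x = 1) {i : ι}
    (hi : χ i x ≠ 0) : frac (χ i x) = 1 / addOrderOf x := by
  have hN : (1 : ℝ) < addOrderOf x := mod_cast H.one_lt_addOrderOf hx
  rw [H.apply_eq_of_ne_zero hx hi,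
    frac_coe_of_mem (by positivity) ((div_lt_one (by positivity)).2 hN)]

theorem addOrderOf_apply_of_ne_zero (H : IsHeightRanking χ ω c rk) (hx : rk x = 1) {i : ι}
    (hi : χ i x ≠ 0) : addOrderOf (χ i x) = addOrderOf x := by
  rw [H.apply_eq_of_ne_zero hx hi, AddCircle.addOrderOf_period_div (addOrderOf_pos x)]

theorem addOrderOf_mul_frac_lt_one (H : IsHeightRanking χ ω c rk) (hx : rk x = 1)
    (hy : IsCosetMin rk x y) (i : ι) : addOrderOf (χ i x) * frac (χ i y) < 1 := by
  by_cases hi : χ i x = 0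
  · rw [hi, addOrderOf_zero, Nat.cast_one, one_mul]
    exact frac_lt_one _
  have hN : (0 : ℝ) < addOrderOf x := mod_cast addOrderOf_pos x
  have h := H.frac_add_pred_mul_lt_one hx hy i
  rw [H.frac_apply_of_ne_zero hx hi, sub_mul, mul_one_div_cancel hN.ne', one_mul] at h
  rw [H.addOrderOf_apply_of_ne_zero hx hi, mul_comm, ← lt_div_iff₀ hN]
  linarith

theorem frac_quotientChar_mk (H : IsHeightRanking χ ω c rk) (hx : rk x = 1)
    (hy : IsCosetMin rk x y) (i : ι) :
    frac (quotientChar χ x i y) = addOrderOf (χ i x) * frac (χ i y) := by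
  rw [quotientChar_mk, frac_nsmul_of_lt (H.addOrderOf_mul_frac_lt_one hx hy i)]

theorem addOrderOf_dvd_rank (H : IsHeightRanking χ ω c rk) (hx : rk x = 1)
    (hy : IsCosetMin rk x y) : addOrderOf x ∣ rk y := by
  induction hv : rk y using Nat.strong_induction_on generalizing y with
  | _ v ih =>
    rcases v with _ | v
    · exact dvd_zero _
    obtain ⟨z, hz⟩ := H.exists_rank_eq (r := v) (by have := H.lt_card y; lia)
    obtain ⟨w, hw, j, hj, rfl⟩ := exists_isCosetMin_add_nsmul rk x z
    have hrk := H.rank_add_nsmul hx hw hj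
    have hdvd := ih (rk w) (by lia) hw rfl
    -- the predecessor in rank of a coset minimum is the last element of its own coset
    have hlast : j + 1 = addOrderOf x := by
      by_contra hne
      have hyw : y = w + (j + 1) • x := H.injective <| by
        rw [H.rank_add_nsmul hx hw (by lia)]; lia
      have h := hy (addOrderOf x - (j + 1))
      rw [hyw, add_assoc, ← add_nsmul, Nat.add_sub_cancel' (by lia), addOrderOf_nsmul_eq_zero,
        add_zero, H.rank_add_nsmul hx hw (by lia)] at h
      lia
    rw [show v + 1 = rk w + addOrderOf x by lia]
    exact dvd_add hdvd dvd_rfl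

theorem quotient (H : IsHeightRanking χ ω c rk) (hx : rk x = 1) :
    ∃ rk', IsHeightRanking (quotientChar χ x) (quotientWeight χ ω x) (c * addOrderOf x) rk' := by
  choose rep hmin hrep using exists_isCosetMin_mk_eq rk x
  choose rk' hrk' using fun q => H.addOrderOf_dvd_rank hx (hmin q)
  have horder : ∀ i, (0 : ℝ) < addOrderOf (χ i x) := fun i => mod_cast
    ((χ i).isOfFinAddOrder (isOfFinAddOrder_of_finite x)).addOrderOf_pos
  have hN := addOrderOf_pos x
  refine ⟨rk', fun i => div_pos (H.weight_pos i) (horder i), mul_pos H.pos (mod_cast hN),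
    fun q => ?_, fun q q' h => ?_, fun q => ?_⟩
  · calc ∑ i, quotientWeight χ ω x i * frac (quotientChar χ x i q)
        = ∑ i, ω i * frac (χ i (rep q)) := Finset.sum_congr rfl fun i _ => by
          nth_rw 1 [← hrep q]
          rw [H.frac_quotientChar_mk hx (hmin q), quotientWeight, ← mul_assoc,
            div_mul_cancel₀ _ (horder i).ne']
      _ = c * addOrderOf x * rk' q := by
          rw [H.height_eq, hrk' q, Nat.cast_mul, mul_assoc]
  · rw [← hrep q, ← hrep q', H.injective (by rw [hrk' q, hrk' q', h] : rk (rep q) = rk (rep q'))]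
  · have h := H.lt_card (rep q)
    rw [AddSubgroup.card_eq_card_quotient_mul_card_addSubgroup (AddSubgroup.zmultiples x),
      Nat.card_zmultiples, hrk' q, mul_comm] at h
    exact lt_of_mul_lt_mul_right h hN.le

theorem sum_weight_of_superset (H : IsHeightRanking χ ω c rk) (hx : rk x = 1) {s : Finset ι}
    (hs : ∀ i, χ i x ≠ 0 → i ∈ s) :
    ∑ i ∈ s, ω i = ∑ i ∈ s, quotientWeight χ ω x i + c * (addOrderOf x - 1) := by
  have hN : (addOrderOf x : ℝ) ≠ 0 := mod_cast (addOrderOf_pos x).ne'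
  rw [← H.sum_mul_frac_of_superset hx hs, Finset.sum_mul, ← Finset.sum_add_distrib]
  refine Finset.sum_congr rfl fun i _ => ?_
  rw [quotientWeight]
  by_cases hi : χ i x = 0
  · rw [hi, addOrderOf_zero, frac_zero, Nat.cast_one, div_one, mul_zero, zero_mul, add_zero]
  · rw [H.addOrderOf_apply_of_ne_zero hx hi, H.frac_apply_of_ne_zero hx hi]
    field_simp
    ring

theorem sum_weight_of_support (H : IsHeightRanking χ ω c rk) (hx : rk x = 1) {s : Finset ι}
    (hs : ∀ i, i ∈ s ↔ χ i x ≠ 0) : ∑ i ∈ s, ω i = c * addOrderOf x := by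
  have hN : (addOrderOf x : ℝ) ≠ 0 := mod_cast (addOrderOf_pos x).ne'
  rw [← H.sum_mul_frac_of_superset hx fun i => (hs i).2, Finset.sum_mul]
  refine Finset.sum_congr rfl fun i hi => ?_
  rw [H.frac_apply_of_ne_zero hx ((hs i).1 hi)]
  field_simp

end IsHeightRanking

/-! ### Generators of cyclic groups with a height ranking -/

section Cyclic

variable {G A : Type*} [AddCommGroup G] [Finite G] [IsAddCyclic G] {x y : G}

theorem mem_zmultiples_of_addOrderOf_dvd (h : addOrderOf y ∣ addOrderOf x) :
    y ∈ AddSubgroup.zmultiples x := by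
  have hle : AddSubgroup.zmultiples x ≤ (nsmulAddMonoidHom (addOrderOf x) : G →+ G).ker := by
    rw [AddSubgroup.zmultiples_le]
    exact addOrderOf_nsmul_eq_zero x
  have hcard : Nat.card (nsmulAddMonoidHom (addOrderOf x) : G →+ G).ker = addOrderOf x := by
    rw [IsAddCyclic.card_nsmulAddMonoidHom_ker, Nat.gcd_eq_right (addOrderOf_dvd_natCard x)]
  rw [AddSubgroup.eq_of_le_of_card_ge hle (by rw [hcard, Nat.card_zmultiples])]
  exact addOrderOf_dvd_iff_nsmul_eq_zero.1 h

theorem injective_of_addOrderOf_apply_eq [AddCommGroup A] {p n : ℕ} (hp : p.Prime)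
    (hcard : Nat.card G = p ^ n) (f : G →+ A) (hx : x ≠ 0)
    (h : addOrderOf (f x) = addOrderOf x) : Function.Injective f := by
  refine (injective_iff_map_eq_zero f).2 fun y hy => ?_
  obtain ⟨a, -, ha⟩ := (Nat.dvd_prime_pow hp).1 (hcard ▸ addOrderOf_dvd_natCard x)
  obtain ⟨b, -, hb⟩ := (Nat.dvd_prime_pow hp).1 (hcard ▸ addOrderOf_dvd_natCard y)
  rcases le_total a b with hab | hba
  · obtain ⟨m, rfl⟩ := AddSubgroup.mem_zmultiples_iff.1 <|
      mem_zmultiples_of_addOrderOf_dvd (x := y) (ha ▸ hb ▸ pow_dvd_pow p hab)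
    simp only [map_zsmul, hy, zsmul_zero, addOrderOf_zero] at h
    exact absurd (AddMonoid.addOrderOf_eq_one_iff.1 h.symm) hx
  · obtain ⟨m, rfl⟩ := AddSubgroup.mem_zmultiples_iff.1 <|
      mem_zmultiples_of_addOrderOf_dvd (x := x) (ha ▸ hb ▸ pow_dvd_pow p hba)
    simp only [map_zsmul, ← addOrderOf_dvd_iff_zsmul_eq_zero, h] at hy ⊢
    exact hy

theorem quotientChar_injective {ι : Type*} {χ : ι → G →+ UnitAddCircle} {i : ι}
    (hi : Function.Injective (χ i)) (x : G) : Function.Injective (quotientChar χ x i) := by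
  refine (injective_iff_map_eq_zero _).2 fun q hq => ?_
  obtain ⟨g, rfl⟩ := QuotientAddGroup.mk_surjective q
  rw [quotientChar_mk, addOrderOf_injective (χ i) hi, ← map_nsmul,
    map_eq_zero_iff (χ i) hi, ← addOrderOf_dvd_iff_nsmul_eq_zero] at hq
  exact (QuotientAddGroup.eq_zero_iff g).2 (mem_zmultiples_of_addOrderOf_dvd hq)

end Cyclic

/-- The combinatorial shape of a generator `g` of a cyclic `p`-group `G` with a height ranking:
`χ i g = 1 / p ^ e (level i)` for exponents `0 = e 0 < ⋯ < e t`, and the total weight of the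
indices above each level is prescribed. Levels are the block numbers `1, …, t` of the paper; level
`0` consists of the indices for which `χ i` is trivial. -/
structure IsStaircase {G ι : Type*} [AddCommGroup G] [Fintype ι] (χ : ι → G →+ UnitAddCircle)
    (ω : ι → ℝ) (c : ℝ) (p t : ℕ) (e : ℕ → ℕ) (level : ι → ℕ) (g : G) : Prop where
  exponent_zero : e 0 = 0
  strictMonoOn : StrictMonoOn e (Set.Iic t)
  card_eq : Nat.card G = p ^ e t
  zmultiples_eq_top : AddSubgroup.zmultiples g = ⊤
  level_le : ∀ i, level i ≤ t
  apply_eq : ∀ i, χ i g = ((1 / (p : ℝ) ^ e (level i) : ℝ) : UnitAddCircle)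
  tail_weight : ∀ j < t, ∑ i with j < level i, ω i =
    c * ((p : ℝ) ^ (e t - e j) + (p : ℝ) ^ (e t - e (j + 1)) - 1)

section RaiseLevel

variable {G ι : Type*} [AddCommGroup G] {χ : ι → G →+ UnitAddCircle} {x : G} {t : ℕ}
  {level : ι → ℕ} {i : ι}

open scoped Classical in
/-- The block numbers after passing from `G ⧸ ⟨x⟩` with `t` blocks to `G`: the indices whose
character does not vanish at `x` form a new top block. -/
noncomputable def raiseLevel (χ : ι → G →+ UnitAddCircle) (x : G) (t : ℕ) (level : ι → ℕ)
    (i : ι) : ℕ :=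
  if χ i x = 0 then level i else t + 1

theorem raiseLevel_of_eq_zero (hi : χ i x = 0) : raiseLevel χ x t level i = level i :=
  if_pos hi

theorem raiseLevel_of_ne_zero (hi : χ i x ≠ 0) : raiseLevel χ x t level i = t + 1 :=
  if_neg hi

end RaiseLevel

theorem strictMonoOn_update {e : ℕ → ℕ} {t n : ℕ} (he : StrictMonoOn e (Set.Iic t))
    (hn : e t < n) : StrictMonoOn (Function.update e (t + 1) n) (Set.Iic (t + 1)) := by
  intro a _ b hb hab
  have hat : a ≤ t := Nat.lt_succ_iff.1 (hab.trans_le hb)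
  rw [Function.update_of_ne (by lia)]
  rcases (Set.mem_Iic.1 hb).eq_or_lt with rfl | hbt
  · rw [Function.update_self]
    exact (he.monotoneOn hat Set.self_mem_Iic hat).trans_lt hn
  · rw [Function.update_of_ne hbt.ne]
    exact he hat (Nat.lt_succ_iff.1 hbt) hab

section Extension

variable {G ι : Type*} [AddCommGroup G] [Fintype ι]
  {χ : ι → G →+ UnitAddCircle} {ω : ι → ℝ} {c c' : ℝ} {rk : G → ℕ} {x y : G}
  {ω' : ι → ℝ} {p n t : ℕ} {e : ℕ → ℕ} {level : ι → ℕ} {q : G ⧸ AddSubgroup.zmultiples x}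

theorem IsStaircase.pow_mul_addOrderOf (S : IsStaircase (quotientChar χ x) ω' c' p t e level q)
    (hcard : Nat.card G = p ^ n) : p ^ e t * addOrderOf x = p ^ n := by
  rw [← hcard, AddSubgroup.card_eq_card_quotient_mul_card_addSubgroup (AddSubgroup.zmultiples x),
    Nat.card_zmultiples, S.card_eq]

variable [Finite G]

theorem IsHeightRanking.apply_eq_of_quotientChar_eq (H : IsHeightRanking χ ω c rk) (hx : rk x = 1)
    (hy : IsCosetMin rk x y) {i : ι} (hi : χ i x ≠ 0) {a : ℝ} (ha0 : 0 ≤ a) (ha1 : a < 1)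
    (h : quotientChar χ x i y = a) : χ i y = ((a / addOrderOf x : ℝ) : UnitAddCircle) := by
  have hN : (addOrderOf x : ℝ) ≠ 0 := mod_cast (addOrderOf_pos x).ne'
  have hfrac := H.frac_quotientChar_mk hx hy i
  rw [h, frac_coe_of_mem ha0 ha1, H.addOrderOf_apply_of_ne_zero hx hi] at hfrac
  rw [hfrac, mul_div_cancel_left₀ _ hN, coe_frac]

theorem IsStaircase.level_eq_of_apply_ne_zero [IsAddCyclic G]
    (S : IsStaircase (quotientChar χ x) ω' c' p t e level q) (hp : p.Prime)
    (hcard : Nat.card G = p ^ n) (H : IsHeightRanking χ ω c rk) (hx : rk x = 1) {i : ι}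
    (hi : χ i x ≠ 0) : level i = t := by
  have hinj : Function.Injective (quotientChar χ x i) := quotientChar_injective
    (injective_of_addOrderOf_apply_eq hp hcard (χ i) (H.ne_zero_of_rank_eq_one hx)
      (H.addOrderOf_apply_of_ne_zero hx hi)) x
  have horder : p ^ e (level i) = p ^ e t := by
    rw [← addOrderOf_coe_one_div_pow hp.pos, ← S.apply_eq i, addOrderOf_injective _ hinj,
      addOrderOf_eq_card_of_zmultiples_eq_top S.zmultiples_eq_top, S.card_eq]
  exact S.strictMonoOn.injOn (S.level_le i) Set.self_mem_Iic
    (Nat.pow_right_injective hp.two_le horder)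

theorem IsStaircase.exists_lift [IsAddCyclic G]
    (S : IsStaircase (quotientChar χ x) ω' c' p t e level q)
    (hp : p.Prime) (hcard : Nat.card G = p ^ n) (H : IsHeightRanking χ ω c rk) (hx : rk x = 1) :
    ∃ g, ∀ i, χ i g = ((1 / (p : ℝ) ^ e (level i) /
      (addOrderOf (χ i x) : ℝ) : ℝ) : UnitAddCircle) := by
  rcases t.eq_zero_or_pos with rfl | ht
  · refine ⟨x, fun i => ?_⟩
    rw [Nat.le_zero.1 (S.level_le i), S.exponent_zero, pow_zero, div_one]
    by_cases hi : χ i x = 0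
    · rw [hi, addOrderOf_zero, Nat.cast_one, div_one, AddCircle.coe_period]
    · rw [H.addOrderOf_apply_of_ne_zero hx hi, H.apply_eq_of_ne_zero hx hi]
  obtain ⟨g, hg, rfl⟩ := exists_isCosetMin_mk_eq rk x q
  refine ⟨g, fun i => ?_⟩
  by_cases hi : χ i x = 0
  · rw [hi, addOrderOf_zero, Nat.cast_one, div_one, ← quotientChar_mk_of_eq_zero hi, S.apply_eq]
  · have het : 0 < e t := S.exponent_zero.symm.trans_lt
      (S.strictMonoOn (Nat.zero_le t) Set.self_mem_Iic ht)
    have hpt : 1 < (p : ℝ) ^ e t := one_lt_pow₀ (mod_cast hp.one_lt) het.ne'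
    rw [H.addOrderOf_apply_of_ne_zero hx hi]
    refine H.apply_eq_of_quotientChar_eq hx hg hi (by positivity) ?_ (S.apply_eq i)
    rwa [S.level_eq_of_apply_ne_zero hp hcard H hx hi, div_lt_one (by positivity)]

theorem IsStaircase.exponent_lt (S : IsStaircase (quotientChar χ x) ω' c' p t e level q)
    (hp : p.Prime) (hcard : Nat.card G = p ^ n) (H : IsHeightRanking χ ω c rk) (hx : rk x = 1) :
    e t < n := by
  rw [← Nat.pow_lt_pow_iff_right hp.one_lt, ← S.pow_mul_addOrderOf hcard]
  exact lt_mul_of_one_lt_right (pow_pos hp.pos _) (H.one_lt_addOrderOf hx)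

theorem IsStaircase.addOrderOf_eq (S : IsStaircase (quotientChar χ x) ω' c' p t e level q)
    (hp : p.Prime) (hcard : Nat.card G = p ^ n) (H : IsHeightRanking χ ω c rk) (hx : rk x = 1) :
    addOrderOf x = p ^ (n - e t) := by
  refine Nat.eq_of_mul_eq_mul_left (pow_pos hp.pos (e t)) ?_
  rw [S.pow_mul_addOrderOf hcard, ← pow_add, Nat.add_sub_cancel' (S.exponent_lt hp hcard H hx).le]

theorem IsStaircase.tail_weight_raiseLevel_of_lt [IsAddCyclic G]
    (S : IsStaircase (quotientChar χ x) (quotientWeight χ ω x) (c * addOrderOf x) p t e level q)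
    (hp : p.Prime) (hcard : Nat.card G = p ^ n) (H : IsHeightRanking χ ω c rk) (hx : rk x = 1)
    {j : ℕ} (hj : j < t) : ∑ i with j < raiseLevel χ x t level i, ω i =
      c * ((p : ℝ) ^ (n - e j) + (p : ℝ) ^ (n - e (j + 1)) - 1) := by
  have hlevel : ∀ {i}, χ i x ≠ 0 → level i = t := S.level_eq_of_apply_ne_zero hp hcard H hx
  have hset : ∀ i, j < raiseLevel χ x t level i ↔ j < level i := fun i => by
    by_cases hi : χ i x = 0
    · rw [raiseLevel_of_eq_zero hi]
    · rw [raiseLevel_of_ne_zero hi, hlevel hi]; lia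
  have hpow : ∀ i ≤ t, (p : ℝ) ^ (n - e i) = p ^ (e t - e i) * addOrderOf x := fun i hi => by
    have h1 := S.exponent_lt hp hcard H hx
    have h2 := S.strictMonoOn.monotoneOn hi Set.self_mem_Iic hi
    rw [S.addOrderOf_eq hp hcard H hx, Nat.cast_pow, ← pow_add]
    congr 1
    lia
  simp only [hset]
  rw [H.sum_weight_of_superset hx fun i hi => by
    rwa [Finset.mem_filter_univ, hlevel hi], S.tail_weight j hj, hpow j hj.le, hpow (j + 1) hj]
  ring

theorem IsStaircase.tail_weight_raiseLevel_top
    (S : IsStaircase (quotientChar χ x) ω' c' p t e level q)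
    (hp : p.Prime) (hcard : Nat.card G = p ^ n) (H : IsHeightRanking χ ω c rk) (hx : rk x = 1) :
    ∑ i with t < raiseLevel χ x t level i, ω i = c * (p : ℝ) ^ (n - e t) := by
  rw [H.sum_weight_of_support hx fun i => ?_, S.addOrderOf_eq hp hcard H hx, Nat.cast_pow]
  rw [Finset.mem_filter_univ]
  by_cases hi : χ i x = 0
  · rw [raiseLevel_of_eq_zero hi]
    exact iff_of_false (S.level_le i).not_gt (not_not.2 hi)
  · rw [raiseLevel_of_ne_zero hi]
    exact iff_of_true t.lt_succ_self hi

theorem zmultiples_eq_top_of_apply_eq {f : G →+ UnitAddCircle} (hp : 0 < p)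
    (hcard : Nat.card G = p ^ n) {g : G} (h : f g = ((1 / (p : ℝ) ^ n : ℝ) : UnitAddCircle)) :
    AddSubgroup.zmultiples g = ⊤ := by
  refine AddSubgroup.eq_top_of_le_card _ ?_
  rw [Nat.card_zmultiples, hcard, ← addOrderOf_coe_one_div_pow hp, ← h]
  exact Nat.le_of_dvd (addOrderOf_pos g) (addOrderOf_map_dvd f g)

theorem IsStaircase.extend [IsAddCyclic G]
    (S : IsStaircase (quotientChar χ x) (quotientWeight χ ω x) (c * addOrderOf x) p t e level q)
    (hp : p.Prime) (hcard : Nat.card G = p ^ n) (H : IsHeightRanking χ ω c rk) (hx : rk x = 1) :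
    ∃ g, IsStaircase χ ω c p (t + 1) (Function.update e (t + 1) n) (raiseLevel χ x t level) g := by
  obtain ⟨g, hg⟩ := S.exists_lift hp hcard H hx
  have he : ∀ {j}, j ≤ t → Function.update e (t + 1) n j = e j := fun hj =>
    Function.update_of_ne (by lia) _ _
  have het : Function.update e (t + 1) n (t + 1) = n := Function.update_self _ _ _
  have happly {i : ι} (hi : χ i x ≠ 0) : χ i g = ((1 / (p : ℝ) ^ n : ℝ) : UnitAddCircle) := by
    rw [hg, S.level_eq_of_apply_ne_zero hp hcard H hx hi, H.addOrderOf_apply_of_ne_zero hx hi,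
      div_div, ← Nat.cast_pow, ← Nat.cast_mul, S.pow_mul_addOrderOf hcard, Nat.cast_pow]
  refine ⟨g, (he t.zero_le).trans S.exponent_zero,
    strictMonoOn_update S.strictMonoOn (S.exponent_lt hp hcard H hx), by rw [hcard, het], ?_,
    fun i => ?_, fun i => ?_, fun j hj => ?_⟩
  · obtain ⟨i, hi⟩ := H.exists_apply_ne_zero hx
    exact zmultiples_eq_top_of_apply_eq hp.pos hcard (happly hi)
  · by_cases hi : χ i x = 0
    · exact (raiseLevel_of_eq_zero hi).trans_le ((S.level_le i).trans t.le_succ)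
    · exact (raiseLevel_of_ne_zero hi).le
  · by_cases hi : χ i x = 0
    · rw [raiseLevel_of_eq_zero hi, he (S.level_le i), hg, hi, addOrderOf_zero, Nat.cast_one,
        div_one]
    · rw [raiseLevel_of_ne_zero hi, het, happly hi]
  · rw [het, he (Nat.lt_succ_iff.1 hj)]
    rcases (Nat.lt_succ_iff.1 hj).eq_or_lt with rfl | hjt
    · rw [S.tail_weight_raiseLevel_top hp hcard H hx, het, Nat.sub_self, pow_zero,
        add_sub_cancel_right]
    · rw [he hjt, S.tail_weight_raiseLevel_of_lt hp hcard H hx hjt]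

end Extension

theorem IsHeightRanking.exists_isStaircase {G ι : Type*} [AddCommGroup G] [Finite G]
    [IsAddCyclic G] [Fintype ι] {χ : ι → G →+ UnitAddCircle} {ω : ι → ℝ} {c : ℝ} {rk : G → ℕ}
    {p n : ℕ} (hp : p.Prime) (hcard : Nat.card G = p ^ n) (H : IsHeightRanking χ ω c rk) :
    ∃ t e level g, IsStaircase χ ω c p t e level g := by
  induction n using Nat.strong_induction_on generalizing G ω c with
  | _ n ih =>
    rcases n.eq_zero_or_pos with rfl | hn
    · have : Subsingleton G := (Nat.card_eq_one_iff_unique.1 (by rw [hcard, pow_zero])).1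
      exact ⟨0, 0, 0, 0, rfl, fun a _ b hb hab => absurd hb (Nat.zero_le a |>.trans_lt hab).not_ge,
        hcard, Subsingleton.elim _ _, fun _ => le_rfl, fun i => by
          rw [map_zero, Pi.zero_apply, pow_zero, div_one, AddCircle.coe_period],
        fun j hj => absurd hj j.not_lt_zero⟩
    obtain ⟨x, hx⟩ := H.exists_rank_eq (r := 1) (hcard ▸ Nat.one_lt_pow hn.ne' hp.one_lt)
    obtain ⟨rk', H'⟩ := H.quotient hx
    have hmul := AddSubgroup.card_eq_card_quotient_mul_card_addSubgroup (AddSubgroup.zmultiples x)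
    rw [Nat.card_zmultiples, hcard] at hmul
    obtain ⟨m, -, hm⟩ := (Nat.dvd_prime_pow hp).1 (Dvd.intro _ hmul.symm)
    have hmn : m < n := by
      rw [← Nat.pow_lt_pow_iff_right hp.one_lt, hmul, hm]
      exact lt_mul_of_one_lt_right (pow_pos hp.pos m) (H.one_lt_addOrderOf hx)
    have : IsAddCyclic (G ⧸ AddSubgroup.zmultiples x) :=
      isAddCyclic_of_surjective _ (QuotientAddGroup.mk'_surjective _)
    obtain ⟨t, e, level, q, S⟩ := ih m hmn hm H'
    obtain ⟨g, hg⟩ := S.extend hp hcard H hx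
    exact ⟨_, _, _, g, hg⟩

namespace IsStaircase

variable {G ι : Type*} [AddCommGroup G] [Fintype ι] {χ : ι → G →+ UnitAddCircle} {ω : ι → ℝ}
  {c : ℝ} {p t : ℕ} {e : ℕ → ℕ} {level : ι → ℕ} {g : G}

theorem sum_level_eq (S : IsStaircase χ ω c p t e level g) {j : ℕ} (hj : j + 1 < t) :
    ∑ i with level i = j + 1, ω i =
      c * ((p : ℝ) ^ (e t - e j) - (p : ℝ) ^ (e t - e (j + 2))) := by
  classical
  have hsplit : ({i | j < level i} : Finset ι) =
      ({i | level i = j + 1} : Finset ι).disjUnion {i | j + 1 < level i}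
        (Finset.disjoint_filter.2 fun i _ h => h.not_gt) := by
    ext i
    simp only [Finset.disjUnion_eq_union, Finset.mem_union, Finset.mem_filter_univ]
    lia
  have hsum := S.tail_weight j (by lia)
  rw [hsplit, Finset.sum_disjUnion, S.tail_weight (j + 1) hj] at hsum
  linear_combination hsum

theorem sum_level_eq_top (S : IsStaircase χ ω c p t e level g) {j : ℕ} (hj : j + 1 = t) :
    ∑ i with level i = j + 1, ω i = c * (p : ℝ) ^ (e t - e j) := by
  have hlevel : ∀ i, level i = j + 1 ↔ j < level i := fun i => by
    have := S.level_le i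
    lia
  simp only [hlevel]
  rw [S.tail_weight j (by lia), hj, Nat.sub_self, pow_zero, add_sub_cancel_right]

theorem sum_level_pos (S : IsStaircase χ ω c p t e level g) (hp : p.Prime) (hc : 0 < c) {j : ℕ}
    (hj : j < t) : 0 < ∑ i with level i = j + 1, ω i := by
  have hp1 : (1 : ℝ) < p := mod_cast hp.one_lt
  rcases (Nat.succ_le_of_lt hj).eq_or_lt with hjt | hjt
  · rw [S.sum_level_eq_top hjt]
    positivity
  · have hlt := S.strictMonoOn (Set.mem_Iic.2 hj.le) (Set.mem_Iic.2 hjt) (show j < j + 2 by lia)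
    have hle := S.strictMonoOn.monotoneOn (Set.mem_Iic.2 hjt) Set.self_mem_Iic hjt
    rw [S.sum_level_eq hjt]
    exact mul_pos hc (sub_pos.2 (pow_lt_pow_right₀ hp1 (by lia)))

theorem level_pos (S : IsStaircase χ ω c p t e level g) {i : ι} (h : ∃ x, χ i x ≠ 0) :
    0 < level i := by
  obtain ⟨x, hx⟩ := h
  obtain ⟨m, rfl⟩ := AddSubgroup.mem_zmultiples_iff.1
    (S.zmultiples_eq_top ▸ AddSubgroup.mem_top x : x ∈ AddSubgroup.zmultiples g)
  refine Nat.pos_of_ne_zero fun h0 => hx ?_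
  rw [map_zsmul, S.apply_eq, h0, S.exponent_zero, pow_zero, div_one, AddCircle.coe_period,
    smul_zero]

theorem card_level_eq (S : IsStaircase χ (fun _ => 1) c p t e level g) {j : ℕ} (hj : j + 1 < t) :
    (Finset.card {i | level i = j + 1} : ℝ) =
      ((p : ℝ) ^ (e t - e j) - (p : ℝ) ^ (e t - e (j + 2))) * c := by
  have h := S.sum_level_eq hj
  rwa [Finset.sum_const, nsmul_one, mul_comm] at h

theorem card_level_eq_top (S : IsStaircase χ (fun _ => 1) c p t e level g) {j : ℕ}
    (hj : j + 1 = t) :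
    (Finset.card {i | level i = j + 1} : ℝ) = (p : ℝ) ^ (e t - e j) * c := by
  have h := S.sum_level_eq_top hj
  rwa [Finset.sum_const, nsmul_one, mul_comm] at h

theorem card_level_pos (S : IsStaircase χ (fun _ => 1) c p t e level g) (hp : p.Prime) (hc : 0 < c)
    {j : ℕ} (hj : j < t) : 0 < Finset.card {i | level i = j + 1} := by
  have h := S.sum_level_pos hp hc hj
  rw [Finset.sum_const, nsmul_one] at h
  exact_mod_cast h

end IsStaircase

/-! ### Lattice points of dilated simplices -/

section Homogenization

variable {ι E : Type*} [AddCommGroup E] [Module ℝ E] (b : AffineBasis ι ℝ E)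

/-- The coordinates of `(x, r)` in the basis of `E × ℝ` formed by the vectors `(b i, 1)`. -/
noncomputable def homCoord (r : ℝ) (x : E) (i : ι) : ℝ :=
  (b.coord i).linear x + r * b.coord i 0

theorem homCoord_zero (x : E) (i : ι) : homCoord b 0 x i = (b.coord i).linear x := by
  rw [homCoord, zero_mul, add_zero]

theorem homCoord_smul (r : ℝ) (x : E) (i : ι) : homCoord b r (r • x) i = r * b.coord i x := by
  rw [homCoord, map_smul, smul_eq_mul, ← mul_add, (b.coord i).decomp', Pi.sub_apply, sub_add_cancel]

theorem homCoord_eq [Fintype ι] {r : ℝ} {x : E} {a : ι → ℝ} (ha : ∑ i, a i = r)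
    (hx : ∑ i, a i • b i = x) : homCoord b r x = a := by
  classical
  funext i
  simp only [homCoord, ← hx, ← ha, map_sum, map_smul, (b.coord i).decomp', Pi.sub_apply,
    b.coord_apply, smul_eq_mul, mul_sub, Finset.sum_sub_distrib, Finset.sum_mul, sub_add_cancel,
    mul_ite, mul_one, mul_zero, Finset.sum_ite_eq, Finset.mem_univ, if_true]

theorem sum_homCoord [Fintype ι] (r : ℝ) (x : E) : ∑ i, homCoord b r x i = r := by
  simp only [homCoord, (b.coord _).decomp', Pi.sub_apply, Finset.sum_add_distrib,
    Finset.sum_sub_distrib, ← Finset.mul_sum, b.sum_coord_apply_eq_one, sub_self, zero_add, mul_one]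

theorem sum_homCoord_smul [Fintype ι] (r : ℝ) (x : E) : ∑ i, homCoord b r x i • b i = x := by
  simp only [homCoord, (b.coord _).decomp', Pi.sub_apply, add_smul, sub_smul, mul_smul,
    Finset.sum_add_distrib, Finset.sum_sub_distrib, ← Finset.smul_sum,
    b.linear_combination_coord_eq_self, smul_zero, sub_zero, add_zero]

theorem mem_smul_convexHull_range_iff [Finite ι] {r : ℝ} (hr : 0 ≤ r) (x : E) :
    x ∈ r • convexHull ℝ (Set.range b) ↔ ∀ i, 0 ≤ homCoord b r x i := by
  cases nonempty_fintype ι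
  rcases hr.eq_or_lt with rfl | hr
  · have hne : (convexHull ℝ (Set.range b)).Nonempty :=
      convexHull_nonempty_iff.2 (Set.range_nonempty_iff_nonempty.2 b.nonempty)
    rw [Set.zero_smul_set hne, Set.mem_zero]
    refine ⟨?_, fun h => ?_⟩
    · rintro rfl i
      rw [homCoord_zero, map_zero]
    · have h0 := (Finset.sum_eq_zero_iff_of_nonneg fun i _ => h i).1 (sum_homCoord b 0 x)
      rw [← sum_homCoord_smul b 0 x]
      exact Finset.sum_eq_zero fun i hi => by rw [h0 i hi, zero_smul]
  · obtain ⟨y, rfl⟩ : ∃ y, x = r • y := ⟨r⁻¹ • x, (smul_inv_smul₀ hr.ne' x).symm⟩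
    rw [Set.smul_mem_smul_set_iff₀ hr.ne', b.convexHull_eq_nonneg_coord]
    simp only [homCoord_smul, mul_nonneg_iff_of_pos_left hr, Set.mem_ofPred_eq]

end Homogenization

theorem coe_sum {ι : Type*} (s : Finset ι) (f : ι → ℝ) :
    ((∑ i ∈ s, f i : ℝ) : UnitAddCircle) = ∑ i ∈ s, (f i : UnitAddCircle) :=
  map_sum (QuotientAddGroup.mk' (AddSubgroup.zmultiples (1 : ℝ))) f s

theorem coe_frac_add_natCast (x : UnitAddCircle) (m : ℕ) :
    ((frac x + m : ℝ) : UnitAddCircle) = x := by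
  rw [AddCircle.coe_add, coe_frac, coe_eq_zero_iff_exists_int.2 ⟨m, (Int.cast_natCast m).symm⟩,
    add_zero]

section AssociatedGroup

variable {ι κ : Type*} [Fintype ι] [Fintype κ] {d : ℕ} {v : ι → Fin d → ℤ}

theorem coe_mem_associatedGroup_iff {a : ι → ℝ} :
    (fun i => (a i : UnitAddCircle)) ∈ associatedGroup v ↔
      (∃ z : Fin d → ℤ, ∑ i, a i • toReal (v i) = toReal z) ∧ ∃ m : ℤ, ∑ i, a i = m := by
  have hcoord : ∀ j, ∑ i, v i j • (a i : UnitAddCircle) = 0 ↔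
      ∃ m : ℤ, (∑ i, a i • toReal (v i)) j = m := fun j => by
    rw [← coe_eq_zero_iff_exists_int, Finset.sum_apply, coe_sum]
    refine Eq.congr_left (Finset.sum_congr rfl fun i _ => ?_)
    rw [← AddCircle.coe_zsmul, zsmul_eq_mul, mul_comm, Pi.smul_apply, smul_eq_mul, toReal]
  refine and_congr ((forall_congr' hcoord).trans ?_) ?_
  · rw [Classical.skolem]
    exact exists_congr fun z => funext_iff.symm
  · rw [← coe_sum, coe_eq_zero_iff_exists_int]

theorem comp_equiv_mem_associatedGroup_iff (σ : κ ≃ ι) {x : ι → UnitAddCircle} :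
    x ∘ σ ∈ associatedGroup (v ∘ σ) ↔ x ∈ associatedGroup v :=
  and_congr (forall_congr' fun j => Eq.congr_left (σ.sum_comp fun i => v i j • x i))
    (Eq.congr_left (σ.sum_comp x))

theorem associatedGroup_comp_equiv (σ : κ ≃ ι) {g : ι → UnitAddCircle}
    (h : associatedGroup v = AddSubgroup.zmultiples g) :
    associatedGroup (v ∘ σ) = AddSubgroup.zmultiples (g ∘ σ) := by
  ext x
  obtain ⟨y, rfl⟩ := σ.injective.surjective_comp_right x
  rw [comp_equiv_mem_associatedGroup_iff, h, AddSubgroup.mem_zmultiples_iff,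
    AddSubgroup.mem_zmultiples_iff]
  exact exists_congr fun m => σ.surjective.injective_comp_right.eq_iff.symm

theorem associatedGroup_eq_zmultiples {g : associatedGroup v} (hg : AddSubgroup.zmultiples g = ⊤) :
    associatedGroup v = AddSubgroup.zmultiples g.1 := by
  have h := congrArg (AddSubgroup.map (associatedGroup v).subtype) hg
  rw [AddMonoidHom.map_zmultiples, ← AddMonoidHom.range_eq_map, AddSubgroup.range_subtype] at h
  exact h.symm

end AssociatedGroup

theorem toReal_injective {d : ℕ} : Function.Injective (toReal : (Fin d → ℤ) → Fin d → ℝ) :=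
  fun _ _ h => funext fun j => Int.cast_injective (congr_fun h j)

theorem finite_setOf_toReal_mem {d : ℕ} {K : Set (Fin d → ℝ)} (hK : IsCompact K) :
    {z : Fin d → ℤ | toReal z ∈ K}.Finite :=
  (Topology.IsClosedEmbedding.piMap fun _ => Int.isClosedEmbedding_coe_real).isCompact_preimage hK
    |>.finite_of_discrete

namespace LatticeSimplex

variable {d : ℕ} (Δ : LatticeSimplex d)

/-- The vertices, as an affine basis of `ℝ^d`. -/
noncomputable def affineBasis : AffineBasis (Fin (d + 1)) ℝ (Fin d → ℝ) where
  toFun i := toReal (Δ.vertex i)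
  ind' := Δ.affineIndependent
  tot' := by
    rw [Δ.affineIndependent.affineSpan_eq_top_iff_card_eq_finrank_add_one, Fintype.card_fin,
      Module.finrank_fin_fun]

theorem affineBasis_apply (i : Fin (d + 1)) : Δ.affineBasis i = toReal (Δ.vertex i) := rfl

theorem coe_homCoord_mem_associatedGroup (n : ℕ) (z : Fin d → ℤ) :
    (fun i => (homCoord Δ.affineBasis n (toReal z) i : UnitAddCircle)) ∈
      associatedGroup Δ.vertex :=
  coe_mem_associatedGroup_iff.2 ⟨⟨z, sum_homCoord_smul Δ.affineBasis n _⟩, n, by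
    rw [sum_homCoord, Int.cast_natCast]⟩

theorem toReal_mem_smul_body_iff {n : ℕ} {z : Fin d → ℤ} :
    toReal z ∈ (n : ℝ) • Δ.body ↔ ∀ i, 0 ≤ homCoord Δ.affineBasis n (toReal z) i :=
  mem_smul_convexHull_range_iff Δ.affineBasis n.cast_nonneg _

theorem finite_setOf_toReal_mem_smul_body (n : ℕ) :
    {z : Fin d → ℤ | toReal z ∈ (n : ℝ) • Δ.body}.Finite :=
  finite_setOf_toReal_mem ((Set.finite_range _).isCompact_convexHull ℝ |>.smul _)

theorem exists_natCast_eq_sum_frac (x : associatedGroup Δ.vertex) :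
    ∃ h : ℕ, ∑ i, frac (x.1 i) = h := by
  have hx : (fun i => (frac (x.1 i) : UnitAddCircle)) ∈ associatedGroup Δ.vertex := by
    simp only [coe_frac, x.2]
  obtain ⟨-, m, hm⟩ := coe_mem_associatedGroup_iff.1 hx
  have hm0 : (0 : ℝ) ≤ m := hm ▸ Finset.sum_nonneg fun i _ => frac_nonneg _
  lift m to ℕ using mod_cast hm0
  exact ⟨m, hm⟩

/-- The height `∑ i, λ_i` of an element of the associated group, for representatives
`0 ≤ λ_i < 1`. -/
noncomputable def height (x : associatedGroup Δ.vertex) : ℕ :=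
  (Δ.exists_natCast_eq_sum_frac x).choose

theorem sum_frac (x : associatedGroup Δ.vertex) : ∑ i, frac (x.1 i) = Δ.height x :=
  (Δ.exists_natCast_eq_sum_frac x).choose_spec

theorem height_le (x : associatedGroup Δ.vertex) : Δ.height x ≤ d + 1 := by
  have h : (Δ.height x : ℝ) ≤ ∑ _i : Fin (d + 1), (1 : ℝ) :=
    (Δ.sum_frac x).symm.trans_le (Finset.sum_le_sum fun i _ => (frac_lt_one _).le)
  rw [Fin.sum_const, nsmul_one] at h
  exact_mod_cast h

theorem exists_toReal_eq (x : associatedGroup Δ.vertex) (m : Fin (d + 1) →₀ ℕ) :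
    ∃ z : Fin d → ℤ, ∑ i, (frac (x.1 i) + m i) • toReal (Δ.vertex i) = toReal z := by
  have hx : (fun i => ((frac (x.1 i) + m i : ℝ) : UnitAddCircle)) ∈ associatedGroup Δ.vertex := by
    simp only [coe_frac_add_natCast, x.2]
  exact (coe_mem_associatedGroup_iff.1 hx).1

/-- The lattice point whose coordinates with respect to the vertices `(v_i, 1)` have fractional
parts `x` and integral parts `m`. -/
noncomputable def latticePoint (x : associatedGroup Δ.vertex) (m : Fin (d + 1) →₀ ℕ) :
    Fin d → ℤ :=
  (Δ.exists_toReal_eq x m).choose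

variable {Δ} {x : associatedGroup Δ.vertex} {m : Fin (d + 1) →₀ ℕ} {n : ℕ}

theorem homCoord_latticePoint (hn : Δ.height x + ∑ i, m i = n) :
    homCoord Δ.affineBasis n (toReal (Δ.latticePoint x m)) = fun i => frac (x.1 i) + m i := by
  refine homCoord_eq _ ?_ (Δ.exists_toReal_eq x m).choose_spec
  rw [Finset.sum_add_distrib, sum_frac, ← hn, Nat.cast_add, Nat.cast_sum]

theorem toReal_latticePoint_mem_smul_body (hn : Δ.height x + ∑ i, m i = n) :
    toReal (Δ.latticePoint x m) ∈ (n : ℝ) • Δ.body := by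
  rw [toReal_mem_smul_body_iff, homCoord_latticePoint hn]
  exact fun i => add_nonneg (frac_nonneg _) (m i).cast_nonneg

theorem exists_latticePoint_eq {z : Fin d → ℤ} (hz : toReal z ∈ (n : ℝ) • Δ.body) :
    ∃ x m, Δ.height x + ∑ i, m i = n ∧ Δ.latticePoint x m = z := by
  set a := homCoord Δ.affineBasis n (toReal z) with ha
  let x : associatedGroup Δ.vertex := ⟨_, Δ.coe_homCoord_mem_associatedGroup n z⟩
  let m : Fin (d + 1) →₀ ℕ := Finsupp.equivFunOnFinite.symm fun i => ⌊a i⌋₊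
  have hsplit : ∀ i, frac (x.1 i) + m i = a i := fun i => by
    rw [frac_coe, Finsupp.equivFunOnFinite_symm_apply_apply,
      natCast_floor_eq_intCast_floor (Δ.toReal_mem_smul_body_iff.1 hz i), Int.fract_add_floor]
  have hn : (Δ.height x + ∑ i, (m i : ℝ)) = n := by
    rw [← sum_frac, ← Finset.sum_add_distrib, Finset.sum_congr rfl fun i _ => hsplit i,
      ha, sum_homCoord]
  refine ⟨x, m, mod_cast hn, toReal_injective ?_⟩
  rw [latticePoint, ← (Δ.exists_toReal_eq x m).choose_spec]
  simp only [hsplit]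
  exact sum_homCoord_smul Δ.affineBasis n _

variable (Δ) in
theorem bijOn_latticePoint (n : ℕ) : Set.BijOn (fun y => Δ.latticePoint y.1 y.2)
    {y : associatedGroup Δ.vertex × (Fin (d + 1) →₀ ℕ) | Δ.height y.1 + ∑ i, y.2 i = n}
    {z | toReal z ∈ (n : ℝ) • Δ.body} := by
  refine ⟨fun y hy => toReal_latticePoint_mem_smul_body hy, ?_, fun z hz => ?_⟩
  · rintro ⟨x, m⟩ hx ⟨y, l⟩ hy (hxy : Δ.latticePoint x m = Δ.latticePoint y l)
    have h : ∀ i, frac (x.1 i) + m i = frac (y.1 i) + l i := by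
      rw [← funext_iff, ← homCoord_latticePoint hx, hxy, homCoord_latticePoint hy]
    have hcoe : ∀ i, x.1 i = y.1 i := fun i => by
      rw [← coe_frac_add_natCast (x.1 i) (m i), h, coe_frac_add_natCast]
    have hnat : ∀ i, m i = l i := fun i => by
      have hi := h i
      rw [hcoe, add_right_inj] at hi
      exact_mod_cast hi
    exact Prod.ext (Subtype.ext (funext hcoe)) (Finsupp.ext hnat)
  · obtain ⟨x, m, hn, rfl⟩ := exists_latticePoint_eq hz
    exact ⟨(x, m), hn, rfl⟩

variable (Δ)

theorem ehrhartCount_body (n : ℕ) : ehrhartCount Δ.body n =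
    {y : associatedGroup Δ.vertex × (Fin (d + 1) →₀ ℕ) | Δ.height y.1 + ∑ i, y.2 i = n}.ncard :=
  (Δ.bijOn_latticePoint n).ncard_eq.symm

instance : Finite (associatedGroup Δ.vertex) := by
  have hfin : ∀ n, {y : associatedGroup Δ.vertex × (Fin (d + 1) →₀ ℕ) |
      Δ.height y.1 + ∑ i, y.2 i = n}.Finite := fun n =>
    (Δ.bijOn_latticePoint n).finite_iff_finite.2 (Δ.finite_setOf_toReal_mem_smul_body n)
  refine Set.finite_univ_iff.1 <|
    (((Set.finite_Iic (d + 1)).biUnion fun n _ => hfin n).image Prod.fst).subset fun x _ => ?_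
  refine ⟨(x, 0), Set.mem_biUnion (Δ.height_le x) ?_, rfl⟩
  simp only [Set.mem_ofPred_eq, Finsupp.coe_zero, Pi.zero_apply, Finset.sum_const_zero, add_zero]

end LatticeSimplex

open PowerSeries in
theorem coeff_mk_one_pow_card {R ι : Type*} [CommSemiring R] [Fintype ι] [DecidableEq ι] (n : ℕ) :
    coeff n ((mk 1 : PowerSeries R) ^ Fintype.card ι) =
      (Finset.finsuppAntidiag (Finset.univ : Finset ι) n).card := by
  rw [← Finset.card_univ, ← Finset.prod_const, coeff_prod]
  simp only [coeff_mk, Pi.one_apply, Finset.prod_const_one, Finset.sum_const, nsmul_one]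

theorem ncard_setOf_add_sum_eq {α ι : Type*} [Fintype α] [Fintype ι] [DecidableEq ι] (h : α → ℕ)
    (n : ℕ) : {y : α × (ι →₀ ℕ) | h y.1 + ∑ i, y.2 i = n}.ncard =
      ∑ a, if h a ≤ n then (Finset.finsuppAntidiag (Finset.univ : Finset ι) (n - h a)).card
        else 0 := by
  have hset : {y : α × (ι →₀ ℕ) | h y.1 + ∑ i, y.2 i = n} =
      ((Finset.univ.filter (h · ≤ n)).sigma fun a =>
        Finset.finsuppAntidiag (Finset.univ : Finset ι) (n - h a)).map
          (Equiv.sigmaEquivProd α (ι →₀ ℕ)).toEmbedding := by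
    ext ⟨a, m⟩
    change h a + Finset.univ.sum m = n ↔ _
    simp only [Finset.mem_coe, Finset.mem_map_equiv,
      Equiv.sigmaEquivProd_symm_apply, Finset.mem_sigma, Finset.mem_filter, Finset.mem_univ,
      true_and, Finset.mem_finsuppAntidiag, Finset.subset_univ, and_true]
    lia
  rw [hset, Set.ncard_coe_finset, Finset.card_map, Finset.card_sigma, Finset.sum_filter]

open PowerSeries in
theorem mk_ncard_setOf_add_sum_eq {α ι : Type*} [Fintype α] [Fintype ι] (h : α → ℕ) :
    mk (fun n => ({y : α × (ι →₀ ℕ) | h y.1 + ∑ i, y.2 i = n}.ncard : ℤ)) =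
      mk 1 ^ Fintype.card ι * ∑ a, X ^ h a := by
  classical
  ext n
  simp only [coeff_mk, Finset.mul_sum, map_sum, coeff_mul_X_pow', coeff_mk_one_pow_card,
    ncard_setOf_add_sum_eq, Nat.cast_sum, Nat.cast_ite, Nat.cast_zero]

theorem exists_equiv_of_card_fiber_eq {α β γ : Type*} [Fintype α] [Fintype β] [DecidableEq γ]
    {f : α → γ} {g : β → γ}
    (h : ∀ c, Finset.card {a | f a = c} = Finset.card {b | g b = c}) :
    ∃ e : α ≃ β, ∀ a, g (e a) = f a := by
  have hfiber : ∀ c, Nonempty ({a // f a = c} ≃ {b // g b = c}) := fun c =>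
    Fintype.card_eq.1 (by rw [Fintype.card_subtype, Fintype.card_subtype, h])
  exact ⟨_, Equiv.ofFiberEquiv_map fun c => (hfiber c).some⟩

theorem exists_sigma_fin_equiv {α γ : Type*} [Fintype α] [DecidableEq γ] {f : α → γ} {s : γ → ℕ}
    (h : ∀ c, Finset.card {a | f a = c} = s c) :
    ∃ σ : (Σ c, Fin (s c)) ≃ α, ∀ y, f (σ y) = y.1 := by
  have hfiber : ∀ c, Nonempty (Fin (s c) ≃ {a // f a = c}) := fun c =>
    Fintype.card_eq.1 (by rw [Fintype.card_subtype, h, Fintype.card_fin])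
  exact ⟨(Equiv.sigmaCongrRight fun c => (hfiber c).some).trans (Equiv.sigmaFiberEquiv f),
    fun y => ((hfiber y.1).some y.2).2⟩

theorem exists_equiv_of_sum_X_pow_eq {R α β : Type*} [Semiring R] [CharZero R] [Fintype α]
    [Fintype β] {f : α → ℕ} {g : β → ℕ}
    (h : ∑ a, (PowerSeries.X : PowerSeries R) ^ f a = ∑ b, PowerSeries.X ^ g b) :
    ∃ e : α ≃ β, ∀ a, g (e a) = f a := by
  refine exists_equiv_of_card_fiber_eq fun n => ?_
  have hn := congrArg (PowerSeries.coeff n) h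
  simp only [map_sum, PowerSeries.coeff_X_pow, Finset.sum_boole, eq_comm (a := n)] at hn
  exact_mod_cast hn

namespace LatticeSimplex

variable {d : ℕ} (Δ : LatticeSimplex d)

theorem deltaSeries_body [Fintype (associatedGroup Δ.vertex)] :
    deltaSeries Δ.body = ∑ x, PowerSeries.X ^ Δ.height x := by
  simp only [deltaSeries, ehrhartCount_body, mk_ncard_setOf_add_sum_eq, Fintype.card_fin]
  rw [← mul_assoc, ← mul_pow, mul_comm (1 - _), PowerSeries.mk_one_mul_one_sub_eq_one, one_pow,
    one_mul]

/-- The coordinates of the associated group, as characters. -/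
def coordChar (i : Fin (d + 1)) : associatedGroup Δ.vertex →+ UnitAddCircle :=
  (Pi.evalAddMonoidHom _ i).comp (associatedGroup Δ.vertex).subtype

theorem coordChar_apply (i : Fin (d + 1)) (x : associatedGroup Δ.vertex) :
    Δ.coordChar i x = x.1 i := rfl

theorem exists_isHeightRanking {N k : ℕ} (hδ : deltaSeries Δ.body =
      ∑ j ∈ Finset.range N, (PowerSeries.X : PowerSeries ℤ) ^ (j * (k + 1))) :
    Nat.card (associatedGroup Δ.vertex) = N ∧
      ∃ rk, IsHeightRanking Δ.coordChar (fun _ => 1) ((k + 1 : ℕ) : ℝ) rk := by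
  have := Fintype.ofFinite (associatedGroup Δ.vertex)
  rw [deltaSeries_body, Finset.sum_range] at hδ
  obtain ⟨e, he⟩ := exists_equiv_of_sum_X_pow_eq hδ
  have hcard : Nat.card (associatedGroup Δ.vertex) = N := (Nat.card_congr e).trans (Nat.card_fin N)
  refine ⟨hcard, fun x => e x, fun _ => one_pos, Nat.cast_pos.2 k.succ_pos, fun x => ?_,
    Fin.val_injective.comp e.injective, fun x => (e x).2.trans_eq hcard.symm⟩
  simp only [one_mul, coordChar_apply]
  rw [sum_frac, ← he, Nat.cast_mul, mul_comm]

end LatticeSimplex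

/-! ### Lattice pyramids -/

theorem exists_basis_last {R M : Type*} [CommRing R] [IsDomain R] [IsPrincipalIdealRing R]
    [AddCommGroup M] [Module R M] [Module.Free R M] [Module.Finite R M] {n : ℕ}
    (hn : Module.finrank R M = n + 1) {φ : M →ₗ[R] R} {u : M} (hu : φ u = 1) :
    ∃ b : Module.Basis (Fin (n + 1)) R M, b (Fin.last n) = u ∧ b.coord (Fin.last n) = φ := by
  have hsurj : Function.Surjective φ := fun r => ⟨r • u, by rw [map_smul, hu, smul_eq_mul, mul_one]⟩
  have hrank : Module.finrank R (LinearMap.ker φ) = n := by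
    have h := Submodule.finrank_quotient_add_finrank (LinearMap.ker φ)
    rw [(φ.quotKerEquivOfSurjective hsurj).finrank_eq, Module.finrank_self, hn, add_comm] at h
    exact Nat.add_right_cancel h
  let b : Module.Basis (Fin (n + 1)) R M :=
    (Module.finBasisOfFinrankEq R (LinearMap.ker φ) hrank).mkFinSnoc u
      (fun r x hx h => by simpa [hu, LinearMap.mem_ker.1 hx] using congrArg φ h)
      (fun z => ⟨-φ z, by simp [hu]⟩)
  have hlast : b (Fin.last n) = u := by simp [b]
  have hinit : ∀ i : Fin n, φ (b i.castSucc) = 0 := fun i => by simp [b]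
  refine ⟨b, hlast, b.ext fun i => ?_⟩
  rw [b.coord_apply, b.repr_self]
  induction i using Fin.lastCases with
  | last => rw [Finsupp.single_eq_same, hlast, hu]
  | cast i => rw [Finsupp.single_eq_of_ne (Fin.castSucc_ne_last i).symm, hinit]

/-- The affine map `x ↦ x U + w`. -/
noncomputable def latticeMap {n : ℕ} (U : Matrix (Fin n) (Fin n) ℤ) (w : Fin n → ℤ) :
    (Fin n → ℝ) →ᵃ[ℝ] (Fin n → ℝ) :=
  (Matrix.vecMulLinear (U.map (Int.cast : ℤ → ℝ))).toAffineMap + AffineMap.const ℝ _ (toReal w)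

theorem latticeMap_toReal {n : ℕ} (U : Matrix (Fin n) (Fin n) ℤ) (w z : Fin n → ℤ) :
    latticeMap U w (toReal z) = toReal (Matrix.vecMul z U + w) := by
  ext j
  simp [latticeMap, toReal, Matrix.vecMul, dotProduct]

theorem latticeMap_toReal_equivFun {n : ℕ} (b : Module.Basis (Fin n) ℤ (Fin n → ℤ))
    (w z : Fin n → ℤ) : latticeMap (Matrix.of b) w (toReal (b.equivFun (z - w))) = toReal z := by
  have h : Matrix.vecMul (b.equivFun (z - w)) (Matrix.of b) = z - w :=
    (Matrix.vecMul_eq_sum _ _).trans (b.sum_equivFun _)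
  rw [latticeMap_toReal, h, sub_add_cancel]

theorem unimodularlyEquivalent_convexHull_range {ι : Type*} {n : ℕ}
    (b : Module.Basis (Fin n) ℤ (Fin n → ℤ)) (w : Fin n → ℤ) (v : ι → Fin n → ℤ) :
    UnimodularlyEquivalent (convexHull ℝ (Set.range fun i => toReal (b.equivFun (v i - w))))
      (convexHull ℝ (Set.range fun i => toReal (v i))) := by
  have hdet : IsUnit (Matrix.of b).det := by
    have h := (Pi.basisFun ℤ (Fin n)).isUnit_det b
    rwa [Pi.basisFun_det] at h
  refine ⟨Matrix.of b, w, Int.isUnit_iff.1 hdet, ?_⟩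
  change _ = latticeMap (Matrix.of b) w '' _
  simp only [AffineMap.image_convexHull, ← Set.range_comp, Function.comp_def,
    latticeMap_toReal_equivFun]

/-- The inclusion `x ↦ (x, 0)` of the hyperplane containing the base of a pyramid. -/
noncomputable def baseInclusion (n : ℕ) : (Fin n → ℝ) →ₗ[ℝ] (Fin (n + 1) → ℝ) where
  toFun x := Fin.snoc (α := fun _ => ℝ) x 0
  map_add' x y := by ext j; induction j using Fin.lastCases <;> simp
  map_smul' r x := by ext j; induction j using Fin.lastCases <;> simp

theorem pyramid_convexHull_range {ι : Type*} {n : ℕ} (q : ι → Fin n → ℝ) :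
    pyramid (convexHull ℝ (Set.range q)) = convexHull ℝ
      (insert (Fin.snoc (α := fun _ => ℝ) (0 : Fin n → ℝ) 1)
        (Set.range fun j => baseInclusion n (q j))) := by
  change convexHull ℝ (insert _ (baseInclusion n '' _)) = _
  rw [LinearMap.image_convexHull, ← Set.range_comp, Set.insert_eq,
    convexHull_convexHull_union_right, ← Set.insert_eq, Function.comp_def]

theorem range_eq_insert_range_succAbove {α : Type*} {n : ℕ} (f : Fin (n + 1) → α)
    (i : Fin (n + 1)) : Set.range f = insert (f i) (Set.range fun j => f (i.succAbove j)) := by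
  conv_lhs => rw [← i.insertNth_self_removeNth f]
  exact Fin.range_insertNth _ _ _

theorem toReal_snoc {n : ℕ} (z : Fin n → ℤ) (m : ℤ) :
    toReal (Fin.snoc (α := fun _ => ℤ) z m) = Fin.snoc (α := fun _ => ℝ) (toReal z) (m : ℝ) := by
  ext j
  induction j using Fin.lastCases <;> simp [toReal]

theorem toReal_zero {n : ℕ} : toReal (0 : Fin n → ℤ) = 0 := funext fun _ => Int.cast_zero

theorem toReal_sub {n : ℕ} (y z : Fin n → ℤ) : toReal (y - z) = toReal y - toReal z := by
  ext j
  simp [toReal]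

theorem exists_intLinearMap {n : ℕ} (f : (Fin n → ℝ) →ₗ[ℝ] ℝ)
    (hf : ∀ z, ∃ m : ℤ, f (toReal z) = m) :
    ∃ φ : (Fin n → ℤ) →ₗ[ℤ] ℤ, ∀ z, f (toReal z) = φ z := by
  choose φ hφ using hf
  refine ⟨(AddMonoidHom.ofMapSub φ fun y z => ?_).toIntLinearMap, hφ⟩
  have h : (φ (y - z) : ℝ) = φ y - φ z := by rw [← hφ, ← hφ, ← hφ, toReal_sub, map_sub]
  exact_mod_cast h

namespace LatticeSimplex

variable {n : ℕ}

theorem exists_intLinearMap_vertex_sub (Δ : LatticeSimplex n) {i₀ j : Fin (n + 1)} (hj : j ≠ i₀)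
    (h : ∀ x ∈ associatedGroup Δ.vertex, x i₀ = 0) :
    ∃ φ : (Fin n → ℤ) →ₗ[ℤ] ℤ, ∀ i, φ (Δ.vertex i - Δ.vertex j) = if i₀ = i then 1 else 0 := by
  have hint : ∀ z, ∃ m : ℤ, (Δ.affineBasis.coord i₀).linear (toReal z) = m := fun z => by
    have hz := h _ (Δ.coe_homCoord_mem_associatedGroup 0 z)
    rwa [coe_eq_zero_iff_exists_int, Nat.cast_zero, homCoord_zero] at hz
  obtain ⟨φ, hφ⟩ := exists_intLinearMap _ hint
  refine ⟨φ, fun i => ?_⟩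
  have hi := hφ (Δ.vertex i - Δ.vertex j)
  rw [toReal_sub, ← affineBasis_apply, ← affineBasis_apply, ← vsub_eq_sub,
    AffineMap.linearMap_vsub, AffineBasis.coord_apply, AffineBasis.coord_apply, if_neg hj.symm,
    vsub_eq_sub, sub_zero] at hi
  exact_mod_cast hi.symm

theorem isLatticePyramid_of_basis (Δ : LatticeSimplex (n + 1))
    (b : Module.Basis (Fin (n + 1)) ℤ (Fin (n + 1) → ℤ)) (w : Fin (n + 1) → ℤ) {i₀ : Fin (n + 2)}
    (hapex : b.equivFun (Δ.vertex i₀ - w) = Fin.snoc (α := fun _ => ℤ) 0 1)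
    {q : Fin (n + 1) → Fin n → ℤ} (hbase : ∀ j,
      b.equivFun (Δ.vertex (i₀.succAbove j) - w) = Fin.snoc (α := fun _ => ℤ) (q j) 0) :
    IsLatticePyramid (n + 1) Δ.body := by
  have hbase' : ∀ j, baseInclusion n (toReal (q j)) =
      toReal (b.equivFun (Δ.vertex (i₀.succAbove j) - w)) := fun j => by
    rw [hbase, toReal_snoc, Int.cast_zero]
    rfl
  have hapex' : Fin.snoc (α := fun _ => ℝ) (0 : Fin n → ℝ) 1 =
      toReal (b.equivFun (Δ.vertex i₀ - w)) := by
    rw [hapex, toReal_snoc, Int.cast_one, toReal_zero]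
  have hind : AffineIndependent ℝ fun j => toReal (q j) := by
    refine .of_comp ((latticeMap (Matrix.of b) w).comp (baseInclusion n).toAffineMap) ?_
    convert Δ.affineIndependent.comp_embedding i₀.succAboveEmb using 1
    funext j
    exact (congrArg _ (hbase' j)).trans (latticeMap_toReal_equivFun b w _)
  refine ⟨⟨q, hind⟩, ?_⟩
  have hpyr : pyramid (convexHull ℝ (Set.range fun j => toReal (q j))) =
      convexHull ℝ (Set.range fun i => toReal (b.equivFun (Δ.vertex i - w))) := by
    rw [pyramid_convexHull_range, range_eq_insert_range_succAbove _ i₀, hapex']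
    simp only [hbase']
  exact hpyr ▸ unimodularlyEquivalent_convexHull_range b w Δ.vertex

theorem isLatticePyramid_of_forall_apply_eq_zero (Δ : LatticeSimplex (n + 1)) {i₀ : Fin (n + 2)}
    (h : ∀ x ∈ associatedGroup Δ.vertex, x i₀ = 0) : IsLatticePyramid (n + 1) Δ.body := by
  obtain ⟨φ, hφ⟩ := Δ.exists_intLinearMap_vertex_sub (i₀.succAbove_ne 0) h
  set w := Δ.vertex (i₀.succAbove 0)
  obtain ⟨b, hb, hcoord⟩ := exists_basis_last (R := ℤ) (Module.finrank_fin_fun ℤ)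
    ((hφ i₀).trans (if_pos rfl))
  refine Δ.isLatticePyramid_of_basis b w (i₀ := i₀) ?_
    (q := fun j => Fin.init (b.equivFun (Δ.vertex (i₀.succAbove j) - w))) fun j => ?_
  · ext j
    rw [b.equivFun_apply, ← hb, b.repr_self]
    induction j using Fin.lastCases with
    | last => rw [Finsupp.single_eq_same, Fin.snoc_last]
    | cast j =>
      rw [Finsupp.single_eq_of_ne (Fin.castSucc_ne_last j), Fin.snoc_castSucc, Pi.zero_apply]
  · have hlast : b.equivFun (Δ.vertex (i₀.succAbove j) - w) (Fin.last n) = 0 := by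
      rw [b.equivFun_apply, ← b.coord_apply, hcoord, hφ, if_neg (i₀.succAbove_ne j).symm]
    conv_lhs => rw [← Fin.snoc_init_self (b.equivFun _), hlast]

theorem exists_coordChar_ne_zero {d : ℕ} (Δ : LatticeSimplex d)
    (hpyr : ¬ IsLatticePyramid d Δ.body) [Nontrivial (associatedGroup Δ.vertex)]
    (i : Fin (d + 1)) : ∃ x, Δ.coordChar i x ≠ 0 := by
  by_contra! h
  cases d with
  | zero =>
    obtain ⟨x, hx⟩ := exists_ne (0 : associatedGroup Δ.vertex)
    refine hx (Subtype.ext (funext fun j => ?_))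
    rw [Subsingleton.elim (α := Fin 1) j i]
    exact h x
  | succ n => exact hpyr (Δ.isLatticePyramid_of_forall_apply_eq_zero fun x hx => h ⟨x, hx⟩)

end LatticeSimplex

end GorensteinSimplex

open GorensteinSimplex in
theorem corollary4p2 (p ℓ k d : ℕ) (hp : p.Prime) (hℓ : 0 < ℓ)
    (Δ : GorensteinSimplex.LatticeSimplex d)
    (hcyc : IsAddCyclic (GorensteinSimplex.associatedGroup Δ.vertex))
    (hδ : GorensteinSimplex.deltaSeries Δ.body =
      ∑ j ∈ Finset.range (p ^ ℓ), (PowerSeries.X : PowerSeries ℤ) ^ (j * (k + 1)))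
    (hpyr : ¬ GorensteinSimplex.IsLatticePyramid d Δ.body) :
    ∃ (t : ℕ) (e s : ℕ → ℕ), 1 ≤ t ∧ e 0 = 0 ∧ StrictMonoOn e (Set.Iic t) ∧ e t = ℓ ∧
      (∀ i, 1 ≤ i → i ≤ t → 0 < s i) ∧
      (∀ i, 1 ≤ i → i < t →
        (s i : ℤ) = ((p : ℤ) ^ (ℓ - e (i - 1)) - (p : ℤ) ^ (ℓ - e (i + 1))) * ((k : ℤ) + 1)) ∧
      s t = p ^ (ℓ - e (t - 1)) * (k + 1) ∧
      ∃ σ : ((i : Finset.Icc 1 t) × Fin (s i)) ≃ Fin (d + 1),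
        GorensteinSimplex.associatedGroup (fun x => Δ.vertex (σ x)) =
          AddSubgroup.zmultiples
            (fun x => (((1 : ℝ) / (p : ℝ) ^ e x.1 : ℝ) : UnitAddCircle)) := by
  obtain ⟨hcard, rk, H⟩ := Δ.exists_isHeightRanking hδ
  obtain ⟨t, e, level, g, S⟩ := H.exists_isStaircase hp hcard
  have het : e t = ℓ := Nat.pow_right_injective hp.two_le (S.card_eq.symm.trans hcard)
  have ht : 1 ≤ t := Nat.pos_of_ne_zero fun h => hℓ.ne' (by rw [← het, h, S.exponent_zero])
  have : Nontrivial (associatedGroup Δ.vertex) :=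
    Finite.one_lt_card_iff_nontrivial.1 (hcard ▸ Nat.one_lt_pow hℓ.ne' hp.one_lt)
  have hlevel : ∀ i, level i ∈ Finset.Icc 1 t := fun i =>
    Finset.mem_Icc.2 ⟨S.level_pos (Δ.exists_coordChar_ne_zero hpyr i), S.level_le i⟩
  obtain ⟨σ, hσ⟩ := exists_sigma_fin_equiv (f := fun i => (⟨level i, hlevel i⟩ : Finset.Icc 1 t))
    (s := fun j => Finset.card {i | level i = j}) fun j => by simp only [Subtype.ext_iff]
  refine ⟨t, e, fun j => Finset.card {i | level i = j}, ht, S.exponent_zero, S.strictMonoOn, het,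
    fun i hi hit => ?_, fun i hi hit => ?_, ?_, σ, ?_⟩
  · obtain ⟨j, rfl⟩ := Nat.exists_eq_add_of_le' hi
    exact S.card_level_pos hp H.pos hit
  · obtain ⟨j, rfl⟩ := Nat.exists_eq_add_of_le' hi
    exact_mod_cast het ▸ S.card_level_eq hit
  · obtain ⟨j, rfl⟩ := Nat.exists_eq_add_of_le' ht
    exact_mod_cast het ▸ S.card_level_eq_top rfl
  · have hg : g.1 ∘ σ = fun x => (((1 : ℝ) / (p : ℝ) ^ e x.1 : ℝ) : UnitAddCircle) :=
      funext fun x => hσ x ▸ S.apply_eq (σ x)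
    exact hg ▸ associatedGroup_comp_equiv σ (associatedGroup_eq_zmultiples S.zmultiples_eq_top)
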